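/- Let $d\in\mathbb{N}$, let $w\in\mathbb{R}^d$ with $w_i\neq 0$ for all $i$, and let $0<\epsilon\le\frac{d-1}{2}$. For $x\in[0,1]^d$ consider the steepest descent problem for the intersection of the $l_1$-ball and the box, $$\max_{\delta\in\mathbb{R}^d}\ \langle w,\delta\rangle\quad\text{subject to}\quad \|\delta\|_1\le\epsilon,\quad x+\delta\in[0,1]^d. \qquad (*)$$ Fix an ordering (permutation) $\pi$ of $\{1,\dots,d\}$ with $|w_{\pi_1}|\ge|w_{\pi_2}|\ge\dots\ge|w_{\pi_d}|$ (chosen independently of $x$). Put $z_i=\max\{(1-x_i)\,\mathrm{sign}(w_i),\,-x_i\,\mathrm{sign}(w_i)\}$, let $k$ be the smallest integer in $\{1,\dots,d\}$ with $\sum_{i=1}^k z_{\pi_i}\ge\epsilon$, and $k=d$ if there is no such integer. The steepest descent step $\delta^*=\delta^*(x)$ is $$\delta^*_{\pi_i}=\begin{cases} z_{\pi_i}\,\mathrm{sign}(w_{\pi_i}) & i<k,\\ \min\{z_{\pi_k},\,\epsilon-\sum_{j=1}^{k-1}z_{\pi_j}\}\,\mathrm{sign}(w_{\pi_k}) & i=k,\\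 0 & i>k.\end{cases}$$ For every $x\in[0,1]^d$ this $\delta^*$ is a solution of $(*)$, and it is the only solution if the numbers $|w_1|,\dots,|w_d|$ are pairwise distinct. If $x$ is a random vector uniformly distributed on $[0,1]^d$, then the number $\|\delta^*\|_0$ of non-zero entries of $\delta^*$ is integrable, and $$\mathbb{E}\big[\|\delta^*\|_0\big]=\lfloor\epsilon+1\rfloor+\sum_{m=\lfloor\epsilon\rfloor+2}^{d}\ \sum_{k=0}^{\lfloor\epsilon\rfloor}(-1)^k\frac{(\epsilon-k)^{m-1}}{k!\,(m-1-k)!}\ \ge\ \frac{\lfloor 3\epsilon\rfloor+1}{2}.$$ -/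

import Mathlib

open scoped Nat

noncomputable section

/-- The effective threat model around `x`, written in terms of the perturbation `δ`:
`‖δ‖₁ ≤ ε` and `x + δ ∈ [0,1]^d`. -/
def feasiblePerturbations {d : ℕ} (x : Fin d → ℝ) (ε : ℝ) : Set (Fin d → ℝ) :=
  {δ | ∑ i, |δ i| ≤ ε ∧ ∀ i, x i + δ i ∈ Set.Icc (0 : ℝ) 1}

/-- `δ` solves the steepest descent problem: maximize `⟨w, δ⟩` subject to
`‖δ‖₁ ≤ ε` and `x + δ ∈ [0,1]^d`. -/
def IsSteepestDescentSolution {d : ℕ} (w x : Fin d → ℝ) (ε : ℝ) (δ : Fin d → ℝ) : Prop :=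
  δ ∈ feasiblePerturbations x ε ∧
    IsMaxOn (fun η : Fin d → ℝ => ∑ i, w i * η i) (feasiblePerturbations x ε) δ

/-- `z_i = max {(1 - x_i) sign w_i, - x_i sign w_i}`. -/
def boxSlack {d : ℕ} (w x : Fin d → ℝ) (i : Fin d) : ℝ :=
  max ((1 - x i) * Real.sign (w i)) (-x i * Real.sign (w i))

/-- `∑_{i=1}^k z_{π_i}`; position `i ∈ {1,…,d}` is `i - 1` in `Fin d`. -/
def slackSum {d : ℕ} (w x : Fin d → ℝ) (π : Equiv.Perm (Fin d)) (k : ℕ) : ℝ :=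
  ∑ i : Fin d with i.val < k, boxSlack w x (π i)

/-- The smallest `k ∈ {1,…,d}` with `∑_{i=1}^k z_{π_i} ≥ ε`, and `k = d` if there is none. -/
def criticalIndex {d : ℕ} (w x : Fin d → ℝ) (ε : ℝ) (π : Equiv.Perm (Fin d)) : ℕ :=
  sInf {k : ℕ | 1 ≤ k ∧ k ≤ d ∧ (ε ≤ slackSum w x π k ∨ k = d)}

/-- The steepest descent step `δ*` for the ordering `π`: with `k` the critical index,
`δ*_{π_i}` is `sign w_{π_i}` times `z_{π_i}` for `i < k`, times what is left of the budget
for `i = k`, and times `0` for `i > k`. The minimum at `i = k` only matters when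
`∑_{i=1}^d z_i < ε`, where the budget exceeds what the box allows and `δ*_{π_d}` saturates. -/
def steepestDescentStep {d : ℕ} (w : Fin d → ℝ) (ε : ℝ) (π : Equiv.Perm (Fin d))
    (x : Fin d → ℝ) : Fin d → ℝ := fun c =>
  let i : ℕ := (π.symm c).val + 1
  let k : ℕ := criticalIndex w x ε π
  if i < k then boxSlack w x c * Real.sign (w c)
  else if i = k then min (boxSlack w x c) (ε - slackSum w x π (k - 1)) * Real.sign (w c)
  else 0

end

/-! With `t_c = sign(w_c) η_c` the optimization is a fractional knapsack: maximize `∑ |w_c| t_c`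
under `t_c ≤ z_c` and a budget `ε`, negative `t_c` being wasteful. The step is the greedy filling,
and the price `l = |w_{π_k}|` of the critical item certifies it: `(|w_c| - l)(τ_c - t_c) ≥ 0` for
every competitor `t` (`stepMagnitude_threshold`). For distinct prices the equality case gives
uniqueness.

Almost surely all slacks are positive. Then the entry in position `m + 1` is non-zero iff the first
`m` slacks sum to less than `ε`, so the norm is a sum of indicators
(`hammingNorm_steepestDescentStep`). The slacks are independent and uniform, since `u ↦ 1 - u`
preserves the uniform law; hence the expectation is `∑_{m<d} F_m(ε)` with `F_m` the Irwin–Hall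
distribution function. Terms with `m ≤ ε` equal 1, and by symmetry terms with `m ≤ 2ε` are at least
1/2, which yields the lower bound. -/

/-! ### Truncated powers and their integrals. -/

/-- The truncated power `u₊ⁿ`, with the convention `u₊⁰ = 𝟙[0 < u]`. -/
noncomputable def truncatedPow (n : ℕ) (u : ℝ) : ℝ := if 0 < u then u ^ n else 0

lemma truncatedPow_of_pos {n : ℕ} {u : ℝ} (hu : 0 < u) : truncatedPow n u = u ^ n := if_pos hu

lemma truncatedPow_of_nonpos {n : ℕ} {u : ℝ} (hu : u ≤ 0) : truncatedPow n u = 0 :=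
  if_neg hu.not_gt

lemma truncatedPow_of_nonneg {n : ℕ} (hn : n ≠ 0) {u : ℝ} (hu : 0 ≤ u) :
    truncatedPow n u = u ^ n := by
  rcases hu.eq_or_lt with rfl | h
  · rw [truncatedPow_of_nonpos le_rfl, zero_pow hn]
  · exact truncatedPow_of_pos h

lemma truncatedPow_monotone (n : ℕ) : Monotone (truncatedPow n) := by
  intro a b hab
  rcases le_or_gt a 0 with ha | ha
  · rw [truncatedPow_of_nonpos ha, truncatedPow]
    split_ifs <;> positivity
  · rw [truncatedPow_of_pos ha, truncatedPow_of_pos (ha.trans_le hab)]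
    gcongr

lemma integral_zero_truncatedPow (n : ℕ) (b : ℝ) :
    ∫ u in (0 : ℝ)..b, truncatedPow n u = truncatedPow (n + 1) b / (n + 1) := by
  rcases le_or_gt b 0 with hb | hb
  · rw [truncatedPow_of_nonpos hb, zero_div]
    refine (intervalIntegral.integral_congr (g := fun _ => (0 : ℝ)) fun u hu => ?_).trans (by simp)
    rw [Set.uIcc_of_ge hb] at hu
    exact truncatedPow_of_nonpos hu.2
  · have h : ∫ u in (0 : ℝ)..b, truncatedPow n u = ∫ u in (0 : ℝ)..b, u ^ n := by
      refine intervalIntegral.integral_congr_ae (Filter.Eventually.of_forall fun u hu => ?_)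
      rw [Set.uIoc_of_le hb.le] at hu
      exact truncatedPow_of_pos hu.1
    rw [h, integral_pow, truncatedPow_of_pos hb]
    simp

lemma integral_truncatedPow_sub (n : ℕ) (t : ℝ) :
    ∫ u in (0 : ℝ)..1, truncatedPow n (t - u) =
      (truncatedPow (n + 1) t - truncatedPow (n + 1) (t - 1)) / (n + 1) := by
  rw [intervalIntegral.integral_comp_sub_left (fun u => truncatedPow n u) t, sub_zero,
    ← intervalIntegral.integral_interval_sub_left (a := 0)
      (truncatedPow_monotone n).intervalIntegrable (truncatedPow_monotone n).intervalIntegrable,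
    integral_zero_truncatedPow, integral_zero_truncatedPow, sub_div]

lemma intervalIntegrable_truncatedPow_sub (n : ℕ) (t a b : ℝ) :
    IntervalIntegrable (fun u => truncatedPow n (t - u)) MeasureTheory.volume a b :=
  Antitone.intervalIntegrable fun _ _ h => truncatedPow_monotone n (by linarith)

/-! ### The Irwin–Hall distribution function. -/

/-- The distribution function `t ↦ ℙ(S < t)` of a sum `S` of `n` independent uniform variables. -/
noncomputable def irwinHallCDF (n : ℕ) (t : ℝ) : ℝ :=
  (∑ k ∈ Finset.range (n + 1), (-1 : ℝ) ^ k * n.choose k * truncatedPow n (t - k)) / n !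

lemma intervalIntegrable_irwinHallCDF_sub (n : ℕ) (t a b : ℝ) :
    IntervalIntegrable (fun u => irwinHallCDF n (t - u)) MeasureTheory.volume a b := by
  refine IntervalIntegrable.div_const ?_ _
  have h : ∀ k ∈ Finset.range (n + 1), IntervalIntegrable
      (fun u => (-1 : ℝ) ^ k * n.choose k * truncatedPow n (t - u - k))
      MeasureTheory.volume a b := fun k _ => by
    simp only [sub_right_comm t _ (k : ℝ)]
    exact (intervalIntegrable_truncatedPow_sub n (t - k) a b).const_mul _
  simpa only [Finset.sum_fn] using IntervalIntegrable.sum _ h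

/-- Convolution with the uniform density; Pascal's rule merges the two truncated powers that each
term produces. This recursion drives every later induction on `n`. -/
lemma integral_irwinHallCDF_sub (n : ℕ) (t : ℝ) :
    ∫ u in (0 : ℝ)..1, irwinHallCDF n (t - u) = irwinHallCDF (n + 1) t := by
  have hn : ((n : ℝ) + 1) ≠ 0 := by positivity
  have hf : (n ! : ℝ) ≠ 0 := by positivity
  unfold irwinHallCDF
  rw [intervalIntegral.integral_div, intervalIntegral.integral_finsetSum]
  · have h : ∀ k ∈ Finset.range (n + 1),
        ∫ u in (0 : ℝ)..1, (-1 : ℝ) ^ k * n.choose k * truncatedPow n (t - u - k) =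
          ((-1 : ℝ) ^ k * n.choose k * truncatedPow (n + 1) (t - k) +
            (-1 : ℝ) ^ (k + 1) * n.choose k * truncatedPow (n + 1) (t - (k + 1 : ℕ))) /
            (n + 1) := fun k _ => by
      simp only [sub_right_comm t _ (k : ℝ)]
      rw [intervalIntegral.integral_const_mul, integral_truncatedPow_sub]
      push_cast
      rw [sub_sub t k 1]
      ring
    rw [Finset.sum_congr rfl h, ← Finset.sum_div, Finset.sum_add_distrib,
      Finset.sum_range_succ' _ (n + 1), Finset.sum_range_succ' _ n, div_div,
      Nat.factorial_succ]
    have h2 : ∑ k ∈ Finset.range (n + 1), (-1 : ℝ) ^ (k + 1) * ((n + 1).choose (k + 1) : ℕ) *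
          truncatedPow (n + 1) (t - (k + 1 : ℕ)) =
        ∑ k ∈ Finset.range n, (-1 : ℝ) ^ (k + 1) * (n.choose (k + 1) : ℕ) *
          truncatedPow (n + 1) (t - (k + 1 : ℕ)) +
        ∑ k ∈ Finset.range (n + 1), (-1 : ℝ) ^ (k + 1) * (n.choose k : ℕ) *
          truncatedPow (n + 1) (t - (k + 1 : ℕ)) := by
      have h3 : ∑ k ∈ Finset.range n, (-1 : ℝ) ^ (k + 1) * (n.choose (k + 1) : ℕ) *
          truncatedPow (n + 1) (t - (k + 1 : ℕ)) =
          ∑ k ∈ Finset.range (n + 1), (-1 : ℝ) ^ (k + 1) * (n.choose (k + 1) : ℕ) *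
          truncatedPow (n + 1) (t - (k + 1 : ℕ)) := by
        rw [Finset.sum_range_succ _ n]
        simp
      rw [h3, ← Finset.sum_add_distrib]
      refine Finset.sum_congr rfl fun k _ => ?_
      rw [Nat.choose_succ_succ]
      push_cast
      ring
    rw [h2]
    congr 1
    · simp only [Nat.choose_zero_right]
      ring
    · push_cast; rfl
  · intro k _
    simp only [sub_right_comm t _ (k : ℝ)]
    exact (intervalIntegrable_truncatedPow_sub n (t - k) 0 1).const_mul _

lemma irwinHallCDF_of_nonpos (n : ℕ) {t : ℝ} (ht : t ≤ 0) : irwinHallCDF n t = 0 := by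
  rw [irwinHallCDF, Finset.sum_eq_zero, zero_div]
  intro k _
  rw [truncatedPow_of_nonpos (by linarith [k.cast_nonneg (α := ℝ)]), mul_zero]

lemma irwinHallCDF_zero_of_pos {t : ℝ} (ht : 0 < t) : irwinHallCDF 0 t = 1 := by
  simp [irwinHallCDF, truncatedPow_of_pos ht]

/-- Reflection `S ↦ n - S`, carried through the convolution by `u ↦ 1 - u`. At `n = 0`, `t = 0` both
terms vanish, hence the exclusion. -/
lemma irwinHallCDF_symm (n : ℕ) :
    ∀ t : ℝ, n ≠ 0 ∨ t ≠ 0 → irwinHallCDF n t + irwinHallCDF n (n - t) = 1 := by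
  induction n with
  | zero =>
    intro t ht
    rcases lt_or_gt_of_ne (ht.resolve_left (by simp)) with h | h
    · rw [irwinHallCDF_of_nonpos 0 h.le, irwinHallCDF_zero_of_pos (by simpa using h), zero_add]
    · rw [irwinHallCDF_of_nonpos 0 (t := _ - t) (by simpa using h.le),
        irwinHallCDF_zero_of_pos h, add_zero]
  | succ n ih =>
    intro t _
    have h : ∫ u in (0 : ℝ)..1, irwinHallCDF n ((n + 1 : ℕ) - t - u) =
        ∫ u in (0 : ℝ)..1, irwinHallCDF n (n - (t - u)) := by
      have := intervalIntegral.integral_comp_sub_left (a := 0) (b := 1)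
        (fun u => irwinHallCDF n ((n + 1 : ℕ) - t - u)) 1
      simp only [sub_zero, sub_self] at this
      rw [← this]
      congr 1
      ext u
      push_cast
      ring_nf
    have h' : IntervalIntegrable (fun u => irwinHallCDF n (n - (t - u)))
        MeasureTheory.volume 0 1 := by
      have := (intervalIntegrable_irwinHallCDF_sub n ((n + 1 : ℕ) - t) 1 0).comp_sub_left 1
      simp only [sub_zero, sub_self] at this
      convert this using 2 with u
      push_cast
      ring_nf
    rw [← integral_irwinHallCDF_sub, ← integral_irwinHallCDF_sub, h,
      ← intervalIntegral.integral_add (intervalIntegrable_irwinHallCDF_sub n t 0 1) h']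
    rw [intervalIntegral.integral_congr_ae (g := fun _ => (1 : ℝ)), intervalIntegral.integral_const]
    · simp
    -- The induction hypothesis can only fail at the single point `u = t`.
    · filter_upwards [MeasureTheory.Measure.ae_ne MeasureTheory.volume t] with u hu _
      exact ih _ (Or.inr (sub_ne_zero.2 (Ne.symm hu)))

/-- Symmetry replaces an alternating binomial identity here: the reflected point `n - t` is
nonpositive. -/
lemma irwinHallCDF_of_le {n : ℕ} {t : ℝ} (h0 : 0 < t) (h : n ≤ t) : irwinHallCDF n t = 1 := by
  have := irwinHallCDF_symm n t (Or.inr h0.ne')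
  rwa [irwinHallCDF_of_nonpos n (t := n - t) (by linarith), add_zero] at this

lemma irwinHallCDF_eq_sum_floor {n : ℕ} {t : ℝ} (ht : 0 ≤ t) (hn : ⌊t⌋₊ < n) :
    irwinHallCDF n t = ∑ k ∈ Finset.range (⌊t⌋₊ + 1),
      (-1 : ℝ) ^ k * ((t - k) ^ n / (k ! * (n - k)!)) := by
  rw [irwinHallCDF, Finset.sum_div]
  symm
  rw [← Finset.sum_subset (Finset.range_mono (Nat.succ_le_succ hn.le))]
  · refine Finset.sum_congr rfl fun k hk => ?_
    have hk' : k ≤ ⌊t⌋₊ := Nat.lt_succ_iff.1 (Finset.mem_range.1 hk)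
    have hkt : (k : ℝ) ≤ t := (Nat.cast_le.2 hk').trans (Nat.floor_le ht)
    rw [truncatedPow_of_nonneg (by omega) (sub_nonneg.2 hkt),
      Nat.cast_choose ℝ (hk'.trans hn.le)]
    field_simp
  · intro k _ hk
    have hk' : ⌊t⌋₊ < k := by simpa [Nat.lt_succ_iff] using hk
    rw [truncatedPow_of_nonpos (sub_nonpos.2 (Nat.lt_of_floor_lt hk').le), mul_zero, zero_div]

/-! ### The law of a sum of independent uniform variables. -/

-- Induction on `s`: Fubini over the value of the new, independent summand reproduces the
-- convolution recursion.
open MeasureTheory ProbabilityTheory in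
theorem measure_sum_uniform_lt {Ω ι : Type*} [MeasurableSpace Ω] {μ : Measure Ω}
    [IsProbabilityMeasure μ] {Y : ι → Ω → ℝ} (hY : ∀ i, Measurable (Y i)) (hind : iIndepFun Y μ)
    (hlaw : ∀ i, μ.map (Y i) = volume.restrict (Set.Icc 0 1)) (s : Finset ι) :
    ∀ t : ℝ, μ.real {ω | ∑ i ∈ s, Y i ω < t} = irwinHallCDF s.card t := by
  classical
  induction s using Finset.induction_on with
  | empty =>
    intro t
    rcases le_or_gt t 0 with h | h
    · simp [irwinHallCDF_of_nonpos 0 h, h.not_gt]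
    · simp [irwinHallCDF_zero_of_pos h, h]
  | insert a s ha ih =>
    intro t
    have hS : Measurable (∑ i ∈ s, Y i) := by fun_prop
    have hI : IndepFun (Y a) (∑ i ∈ s, Y i) μ :=
      (hind.indepFun_finsetSum_of_notMem hY ha).symm
    have hP : μ.map (fun ω => (Y a ω, (∑ i ∈ s, Y i) ω)) =
        (volume.restrict (Set.Icc 0 1)).prod (μ.map (∑ i ∈ s, Y i)) := by
      rw [(indepFun_iff_map_prod_eq_prod_map_map (hY a).aemeasurable hS.aemeasurable).1 hI, hlaw]
    have hm : MeasurableSet {p : ℝ × ℝ | p.1 + p.2 < t} :=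
      measurableSet_lt (by fun_prop) measurable_const
    have := Measure.isProbabilityMeasure_map (μ := μ) hS.aemeasurable
    have h1 : μ {ω | ∑ i ∈ insert a s, Y i ω < t} =
        ∫⁻ u in Set.Icc (0 : ℝ) 1, ENNReal.ofReal (irwinHallCDF s.card (t - u)) := by
      have : {ω | ∑ i ∈ insert a s, Y i ω < t} =
          (fun ω => (Y a ω, (∑ i ∈ s, Y i) ω)) ⁻¹' {p : ℝ × ℝ | p.1 + p.2 < t} := by
        ext ω
        simp [Finset.sum_insert ha]
      rw [this, ← Measure.map_apply ((hY a).prodMk hS) hm, hP, Measure.prod_apply hm]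
      refine lintegral_congr fun u => ?_
      rw [← ih, ofReal_measureReal, Measure.map_apply hS (measurable_prodMk_left hm)]
      congr 1
      ext ω
      simp [lt_sub_iff_add_lt']
    have hnn : ∀ u, 0 ≤ irwinHallCDF s.card u := fun u => ih u ▸ measureReal_nonneg
    rw [measureReal_def, h1, ← ofReal_integral_eq_lintegral_ofReal,
      ENNReal.toReal_ofReal (integral_nonneg fun u => hnn _), Finset.card_insert_of_notMem ha,
      integral_Icc_eq_integral_Ioc, ← intervalIntegral.integral_of_le zero_le_one,
      integral_irwinHallCDF_sub]
    · rw [← IntegrableOn, integrableOn_Icc_iff_integrableOn_Ioc,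
        ← intervalIntegrable_iff_integrableOn_Ioc_of_le zero_le_one]
      exact intervalIntegrable_irwinHallCDF_sub _ _ _ _
    · exact Filter.Eventually.of_forall fun u => hnn _

lemma Real.sign_mul_sign_of_ne_zero {a : ℝ} (ha : a ≠ 0) : Real.sign a * Real.sign a = 1 := by
  rcases lt_or_gt_of_ne ha with h | h
  · rw [Real.sign_of_neg h]; ring
  · rw [Real.sign_of_pos h]; ring

lemma Real.abs_sign_of_ne_zero {a : ℝ} (ha : a ≠ 0) : |Real.sign a| = 1 := by
  rcases lt_or_gt_of_ne ha with h | h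
  · simp [Real.sign_of_neg h]
  · simp [Real.sign_of_pos h]

lemma eq_sign_mul_iff {a b c : ℝ} (ha : a ≠ 0) : Real.sign a * b = c ↔ b = c * Real.sign a := by
  have := Real.sign_mul_sign_of_ne_zero ha
  constructor
  · rintro rfl
    linear_combination (-b) * this
  · rintro rfl
    linear_combination c * this

/-! ### Fractional knapsack with a threshold price. -/

section Knapsack

variable {ι : Type*} [Fintype ι] {a τ t : ι → ℝ} {l : ℝ}

/-- Optimality of a greedy allocation `τ` with threshold price `l`. -/
lemma sum_mul_le_sum_mul_of_threshold (hl : 0 ≤ l) (h : ∀ c, 0 ≤ (a c - l) * (τ c - t c))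
    (hsum : ∑ c, t c ≤ ∑ c, τ c) : ∑ c, a c * t c ≤ ∑ c, a c * τ c := by
  have h1 : ∑ c, a c * τ c - ∑ c, a c * t c =
      ∑ c, (a c - l) * (τ c - t c) + l * (∑ c, τ c - ∑ c, t c) := by
    rw [← Finset.sum_sub_distrib, ← Finset.sum_sub_distrib, Finset.mul_sum,
      ← Finset.sum_add_distrib]
    exact Finset.sum_congr rfl fun c _ => by ring
  have h2 := Finset.sum_nonneg fun c (_ : c ∈ Finset.univ) => h c
  have h3 := mul_nonneg hl (sub_nonneg.2 hsum)
  linarith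

/-- The gap between the two values is a sum of nonnegative terms, so all of them vanish. This fixes
every coordinate priced differently from `l`; as `l > 0`, the budgets agree too, which fixes `c₀`.
-/
lemma eq_of_sum_mul_le_of_threshold (hl : 0 < l) (h : ∀ c, 0 ≤ (a c - l) * (τ c - t c))
    (hsum : ∑ c, t c ≤ ∑ c, τ c) (hle : ∑ c, a c * τ c ≤ ∑ c, a c * t c) {c₀ : ι}
    (hne : ∀ c, c ≠ c₀ → a c ≠ l) : t = τ := by
  classical
  have h1 : ∑ c, a c * τ c - ∑ c, a c * t c =
      ∑ c, (a c - l) * (τ c - t c) + l * (∑ c, τ c - ∑ c, t c) := by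
    rw [← Finset.sum_sub_distrib, ← Finset.sum_sub_distrib, Finset.mul_sum,
      ← Finset.sum_add_distrib]
    exact Finset.sum_congr rfl fun c _ => by ring
  have h2 := Finset.sum_nonneg fun c (_ : c ∈ Finset.univ) => h c
  have h3 := mul_nonneg hl.le (sub_nonneg.2 hsum)
  have h4 : ∑ c, (a c - l) * (τ c - t c) = 0 := by linarith
  have h5 : l * (∑ c, τ c - ∑ c, t c) = 0 := by linarith
  have h6 : ∀ c, c ≠ c₀ → t c = τ c := fun c hc => by
    have := (Finset.sum_eq_zero_iff_of_nonneg fun c _ => h c).1 h4 c (Finset.mem_univ c)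
    have := (mul_eq_zero.1 this).resolve_left (sub_ne_zero.2 (hne c hc))
    linarith
  have h7 : ∑ c, (τ c - t c) = 0 := by
    rw [Finset.sum_sub_distrib]
    exact (mul_eq_zero.1 h5).resolve_left hl.ne'
  rw [Finset.sum_eq_single c₀ (fun c _ hc => by rw [h6 c hc, sub_self]) (by simp)] at h7
  ext c
  by_cases hc : c = c₀
  · rw [hc]; linarith
  · exact h6 c hc

end Knapsack

/-! ### The greedy step: optimality, uniqueness and support. -/

section Step

variable {d : ℕ} {w x : Fin d → ℝ} {ε : ℝ} {π : Equiv.Perm (Fin d)}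

lemma boxSlack_of_pos {i : Fin d} (h : 0 < w i) : boxSlack w x i = 1 - x i := by
  rw [boxSlack, Real.sign_of_pos h, max_eq_left] <;> linarith

lemma boxSlack_of_neg {i : Fin d} (h : w i < 0) : boxSlack w x i = x i := by
  rw [boxSlack, Real.sign_of_neg h, max_eq_right] <;> linarith

lemma boxSlack_nonneg (hw : ∀ i, w i ≠ 0) (hx : x ∈ Set.Icc (0 : Fin d → ℝ) 1) (i : Fin d) :
    0 ≤ boxSlack w x i := by
  have h0 : 0 ≤ x i := hx.1 i
  have h1 : x i ≤ 1 := hx.2 i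
  rcases lt_or_gt_of_ne (hw i) with h | h
  · rwa [boxSlack_of_neg h]
  · rw [boxSlack_of_pos h]; linarith

lemma slackSum_zero : slackSum w x π 0 = 0 := by simp [slackSum]

lemma slackSum_succ {j : ℕ} (hj : j < d) :
    slackSum w x π (j + 1) = slackSum w x π j + boxSlack w x (π ⟨j, hj⟩) := by
  have : (Finset.univ.filter fun i : Fin d => i.val < j + 1) =
      insert ⟨j, hj⟩ (Finset.univ.filter fun i : Fin d => i.val < j) := by
    ext i
    simp only [Finset.mem_filter, Finset.mem_univ, true_and, Finset.mem_insert, Fin.ext_iff]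
    omega
  rw [slackSum, this, Finset.sum_insert (by simp), add_comm, slackSum]

lemma slackSum_self : slackSum w x π d = ∑ i, boxSlack w x i := by
  rw [slackSum, Finset.filter_true_of_mem fun i _ => i.isLt]
  exact Equiv.sum_comp π (boxSlack w x)

lemma slackSum_mono (hw : ∀ i, w i ≠ 0) (hx : x ∈ Set.Icc (0 : Fin d → ℝ) 1) :
    Monotone (slackSum w x π) := by
  intro j l hjl
  refine Finset.sum_le_sum_of_subset_of_nonneg ?_ fun i _ _ => boxSlack_nonneg hw hx _
  exact Finset.monotone_filter_right _ fun i _ hi => lt_of_lt_of_le hi hjl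

lemma criticalIndex_mem (hd : 1 ≤ d) : 1 ≤ criticalIndex w x ε π ∧ criticalIndex w x ε π ≤ d ∧
    (ε ≤ slackSum w x π (criticalIndex w x ε π) ∨ criticalIndex w x ε π = d) :=
  Nat.sInf_mem (s := {k : ℕ | 1 ≤ k ∧ k ≤ d ∧ (ε ≤ slackSum w x π k ∨ k = d)})
    ⟨d, hd, le_rfl, Or.inr rfl⟩

lemma slackSum_criticalIndex_pred_lt (hd : 1 ≤ d) (hε : 0 < ε) :
    slackSum w x π (criticalIndex w x ε π - 1) < ε := by
  obtain ⟨h1, h2, -⟩ := criticalIndex_mem (w := w) (x := x) (ε := ε) (π := π) hd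
  rcases h1.eq_or_lt with h | h
  · rw [← h, Nat.sub_self, slackSum_zero]
    exact hε
  · by_contra! hcon
    exact Nat.notMem_of_lt_sInf (m := criticalIndex w x ε π - 1) (Nat.sub_lt (by omega) one_pos)
      ⟨by omega, by omega, Or.inl hcon⟩

/-- The modulus of the steepest descent step. -/
noncomputable def stepMagnitude {d : ℕ} (w : Fin d → ℝ) (ε : ℝ) (π : Equiv.Perm (Fin d))
    (x : Fin d → ℝ) (c : Fin d) : ℝ :=
  if (π.symm c).val + 1 < criticalIndex w x ε π then boxSlack w x c
  else if (π.symm c).val + 1 = criticalIndex w x ε π then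
    min (boxSlack w x c) (ε - slackSum w x π (criticalIndex w x ε π - 1))
  else 0

lemma steepestDescentStep_eq (c : Fin d) :
    steepestDescentStep w ε π x c = stepMagnitude w ε π x c * Real.sign (w c) := by
  simp only [steepestDescentStep, stepMagnitude]
  split_ifs <;> simp

lemma stepMagnitude_nonneg (hw : ∀ i, w i ≠ 0) (hε : 0 < ε)
    (hx : x ∈ Set.Icc (0 : Fin d → ℝ) 1) (c : Fin d) : 0 ≤ stepMagnitude w ε π x c := by
  have hz := boxSlack_nonneg hw hx c
  have := slackSum_criticalIndex_pred_lt (w := w) (x := x) (π := π) c.pos hε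
  rw [stepMagnitude]
  split_ifs
  · exact hz
  · exact le_min hz (by linarith)
  · exact le_rfl

lemma stepMagnitude_le (hw : ∀ i, w i ≠ 0) (hx : x ∈ Set.Icc (0 : Fin d → ℝ) 1) (c : Fin d) :
    stepMagnitude w ε π x c ≤ boxSlack w x c := by
  rw [stepMagnitude]
  split_ifs
  · exact le_rfl
  · exact min_le_left _ _
  · exact boxSlack_nonneg hw hx c

/-- Only position `k` is capped, and `S_{k-1} + min(z_k, ε - S_{k-1}) = min(S_k, ε)` for the partial
slack sums `S`. -/
lemma sum_stepMagnitude (hd : 1 ≤ d) :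
    ∑ c, stepMagnitude w ε π x c = min (slackSum w x π (criticalIndex w x ε π)) ε := by
  obtain ⟨h1, h2, -⟩ := criticalIndex_mem (w := w) (x := x) (ε := ε) (π := π) hd
  obtain ⟨j, hj⟩ : ∃ j, criticalIndex w x ε π = j + 1 := ⟨_, (Nat.sub_add_cancel h1).symm⟩
  have hjd : j < d := by omega
  rw [← Equiv.sum_comp π]
  have h : ∀ i, stepMagnitude w ε π x (π i) = (if i.val < j then boxSlack w x (π i) else 0) +
      if i = ⟨j, hjd⟩ then min (boxSlack w x (π ⟨j, hjd⟩)) (ε - slackSum w x π j) else 0 := by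
    intro i
    rw [stepMagnitude, Equiv.symm_apply_apply, hj]
    rcases lt_trichotomy i.val j with h | h | h
    · simp [h, h.ne, Fin.ext_iff]
    · obtain rfl : i = ⟨j, hjd⟩ := Fin.ext h
      simp
    · simp [h.not_gt, h.ne', Fin.ext_iff]
  rw [Finset.sum_congr rfl fun i _ => h i, Finset.sum_add_distrib, ← Finset.sum_filter,
    Finset.sum_ite_eq' Finset.univ, if_pos (Finset.mem_univ _), hj, slackSum_succ hjd,
    ← slackSum, ← min_add_add_left, add_sub_cancel]

/-- Either the step spends the whole budget, or `k = d` and its total is the smaller of the full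
slack and `ε`. -/
lemma sum_le_sum_stepMagnitude (hd : 1 ≤ d) {t : Fin d → ℝ} (htz : ∀ c, t c ≤ boxSlack w x c)
    (htε : ∑ c, t c ≤ ε) : ∑ c, t c ≤ ∑ c, stepMagnitude w ε π x c := by
  obtain ⟨-, -, h | h⟩ := criticalIndex_mem (w := w) (x := x) (ε := ε) (π := π) hd
  · rwa [sum_stepMagnitude hd, min_eq_right h]
  · rw [sum_stepMagnitude hd, h, slackSum_self]
    exact le_min (Finset.sum_le_sum fun c _ => htz c) htε

/-- Items before `k₀` cost at least the threshold and are full; items after it cost at most the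
threshold and are empty. -/
lemma stepMagnitude_threshold (hπ : Antitone fun i => |w (π i)|) {k₀ : Fin d}
    (hk₀ : k₀.val + 1 = criticalIndex w x ε π) {t : Fin d → ℝ} (ht0 : ∀ c, 0 ≤ t c)
    (htz : ∀ c, t c ≤ boxSlack w x c) (c : Fin d) :
    0 ≤ (|w c| - |w (π k₀)|) * (stepMagnitude w ε π x c - t c) := by
  obtain ⟨i, rfl⟩ := π.surjective c
  rw [stepMagnitude, Equiv.symm_apply_apply, ← hk₀]
  rcases lt_trichotomy i k₀ with h | rfl | h
  · rw [if_pos (Nat.add_lt_add_right h 1)]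
    exact mul_nonneg (sub_nonneg.2 (hπ h.le)) (sub_nonneg.2 (htz _))
  · simp
  · have h' : k₀.val < i.val := h
    rw [if_neg (by omega), if_neg (by omega)]
    exact mul_nonneg_of_nonpos_of_nonpos (sub_nonpos.2 (hπ h.le)) (by linarith [ht0 (π i)])

lemma sign_mul_le_boxSlack {η : Fin d → ℝ} (hη : η ∈ feasiblePerturbations x ε) (c : Fin d) :
    Real.sign (w c) * η c ≤ boxSlack w x c := by
  obtain ⟨h0, h1⟩ := hη.2 c
  rcases lt_trichotomy (w c) 0 with h | h | h
  · rw [boxSlack_of_neg h, Real.sign_of_neg h]; linarith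
  · simp [boxSlack, h]
  · rw [boxSlack_of_pos h, Real.sign_of_pos h]; linarith

lemma steepestDescentStep_mem (hw : ∀ i, w i ≠ 0) (hd : 1 ≤ d) (hε : 0 < ε)
    (hx : x ∈ Set.Icc (0 : Fin d → ℝ) 1) :
    steepestDescentStep w ε π x ∈ feasiblePerturbations x ε := by
  refine ⟨?_, fun c => ?_⟩
  · have : ∀ c, |steepestDescentStep w ε π x c| = stepMagnitude w ε π x c := fun c => by
      rw [steepestDescentStep_eq, abs_mul, Real.abs_sign_of_ne_zero (hw c), mul_one,
        abs_of_nonneg (stepMagnitude_nonneg hw hε hx c)]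
    simp only [this]
    rw [sum_stepMagnitude hd]
    exact min_le_right _ _
  · have h0 := stepMagnitude_nonneg (π := π) hw hε hx c
    have h1 := stepMagnitude_le (ε := ε) (π := π) hw hx c
    have hx0 : 0 ≤ x c := hx.1 c
    have hx1 : x c ≤ 1 := hx.2 c
    rw [steepestDescentStep_eq]
    rcases lt_or_gt_of_ne (hw c) with h | h
    · rw [boxSlack_of_neg h] at h1
      rw [Real.sign_of_neg h]
      constructor <;> linarith
    · rw [boxSlack_of_pos h] at h1
      rw [Real.sign_of_pos h]
      constructor <;> linarith

lemma mul_eq_abs_mul_sign_mul (a b : ℝ) : a * b = |a| * (Real.sign a * b) := by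
  rcases lt_trichotomy a 0 with h | rfl | h
  · rw [Real.sign_of_neg h, abs_of_neg h]; ring
  · simp
  · rw [Real.sign_of_pos h, abs_of_pos h]; ring

lemma sum_mul_steepestDescentStep (hw : ∀ i, w i ≠ 0) :
    ∑ c, w c * steepestDescentStep w ε π x c = ∑ c, |w c| * stepMagnitude w ε π x c := by
  refine Finset.sum_congr rfl fun c _ => ?_
  rw [mul_eq_abs_mul_sign_mul, (eq_sign_mul_iff (hw c)).2 (steepestDescentStep_eq c)]

lemma sum_sign_mul_posPart_le (hw : ∀ i, w i ≠ 0) {η : Fin d → ℝ}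
    (hη : η ∈ feasiblePerturbations x ε) : ∑ c, max (Real.sign (w c) * η c) 0 ≤ ε := by
  refine (Finset.sum_le_sum fun c _ => ?_).trans hη.1
  refine max_le ((le_abs_self _).trans ?_) (abs_nonneg _)
  rw [abs_mul, Real.abs_sign_of_ne_zero (hw c), one_mul]

lemma sum_mul_le_sum_abs_mul_posPart (η : Fin d → ℝ) :
    ∑ c, w c * η c ≤ ∑ c, |w c| * max (Real.sign (w c) * η c) 0 := by
  refine Finset.sum_le_sum fun c _ => ?_
  rw [mul_eq_abs_mul_sign_mul]
  exact mul_le_mul_of_nonneg_left (le_max_left _ _) (abs_nonneg _)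

lemma exists_fin_criticalIndex (hd : 1 ≤ d) :
    ∃ k₀ : Fin d, k₀.val + 1 = criticalIndex w x ε π := by
  obtain ⟨h1, h2, -⟩ := criticalIndex_mem (w := w) (x := x) (ε := ε) (π := π) hd
  exact ⟨⟨criticalIndex w x ε π - 1, by omega⟩, by simp only; omega⟩

theorem isSteepestDescentSolution_step (hw : ∀ i, w i ≠ 0) (hπ : Antitone fun i => |w (π i)|)
    (hd : 1 ≤ d) (hε : 0 < ε) (hx : x ∈ Set.Icc (0 : Fin d → ℝ) 1) :
    IsSteepestDescentSolution w x ε (steepestDescentStep w ε π x) := by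
  refine ⟨steepestDescentStep_mem hw hd hε hx, fun η hη => ?_⟩
  obtain ⟨k₀, hk₀⟩ := exists_fin_criticalIndex (w := w) (x := x) (ε := ε) (π := π) hd
  have htz : ∀ c, max (Real.sign (w c) * η c) 0 ≤ boxSlack w x c := fun c =>
    max_le (sign_mul_le_boxSlack hη c) (boxSlack_nonneg hw hx c)
  change ∑ c, w c * η c ≤ ∑ c, w c * steepestDescentStep w ε π x c
  rw [sum_mul_steepestDescentStep hw]
  exact (sum_mul_le_sum_abs_mul_posPart η).trans <|
    sum_mul_le_sum_mul_of_threshold (abs_nonneg (w (π k₀)))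
      (stepMagnitude_threshold hπ hk₀ (fun c => le_max_right _ _) htz)
      (sum_le_sum_stepMagnitude hd htz (sum_sign_mul_posPart_le hw hη))

theorem IsSteepestDescentSolution.eq_step (hw : ∀ i, w i ≠ 0)
    (hπ : Antitone fun i => |w (π i)|) (hinj : Function.Injective fun i => |w i|)
    (hd : 1 ≤ d) (hε : 0 < ε) (hx : x ∈ Set.Icc (0 : Fin d → ℝ) 1) {δ : Fin d → ℝ}
    (hδ : IsSteepestDescentSolution w x ε δ) : δ = steepestDescentStep w ε π x := by
  obtain ⟨k₀, hk₀⟩ := exists_fin_criticalIndex (w := w) (x := x) (ε := ε) (π := π) hd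
  have htz : ∀ c, max (Real.sign (w c) * δ c) 0 ≤ boxSlack w x c := fun c =>
    max_le (sign_mul_le_boxSlack hδ.1 c) (boxSlack_nonneg hw hx c)
  have hmax : ∑ c, w c * steepestDescentStep w ε π x c ≤ ∑ c, w c * δ c :=
    hδ.2 (steepestDescentStep_mem hw hd hε hx)
  rw [sum_mul_steepestDescentStep hw] at hmax
  have hle := sum_mul_le_sum_abs_mul_posPart (w := w) δ
  have hthr := stepMagnitude_threshold hπ hk₀ (fun c => le_max_right _ _) htz
  have hsum := sum_le_sum_stepMagnitude (π := π) hd htz (sum_sign_mul_posPart_le hw hδ.1)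
  have ht := eq_of_sum_mul_le_of_threshold (abs_pos.2 (hw (π k₀))) hthr hsum (hmax.trans hle)
    fun c hc h => hc (hinj h)
  have hge := sum_mul_le_sum_mul_of_threshold (abs_nonneg (w (π k₀))) hthr hsum
  -- So far only the positive parts of `sign(w_c) δ_c` are known. Equality of the two objective
  -- values, taken termwise, rules out negative parts.
  have hterm := (Finset.sum_eq_sum_iff_of_le fun c _ => by
    rw [mul_eq_abs_mul_sign_mul]
    exact mul_le_mul_of_nonneg_left (le_max_left _ _) (abs_nonneg _)).1
    (hle.antisymm (hge.trans hmax))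
  ext c
  rw [steepestDescentStep_eq, ← congrFun ht c, ← eq_sign_mul_iff (hw c)]
  have := hterm c (Finset.mem_univ c)
  rw [mul_eq_abs_mul_sign_mul] at this
  exact mul_left_cancel₀ (abs_pos.2 (hw c)).ne' this

/-- Minimality of the critical index plus monotone partial sums. The bound `m < d` covers the
default value `k = d`. -/
lemma lt_criticalIndex_iff (hw : ∀ i, w i ≠ 0) (hε : 0 < ε)
    (hx : x ∈ Set.Icc (0 : Fin d → ℝ) 1) {m : ℕ} (hm : m < d) :
    m < criticalIndex w x ε π ↔ slackSum w x π m < ε := by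
  have hd : 1 ≤ d := by omega
  have hmono := slackSum_mono (π := π) hw hx
  obtain ⟨h1, h2, h3⟩ := criticalIndex_mem (w := w) (x := x) (ε := ε) (π := π) hd
  refine ⟨fun h => (hmono (Nat.le_sub_one_of_lt h)).trans_lt
    (slackSum_criticalIndex_pred_lt hd hε), fun h => ?_⟩
  by_contra! hcon
  rcases h3 with h3 | h3
  · exact (h3.trans (hmono hcon)).not_gt h
  · omega

lemma hammingNorm_steepestDescentStep (hw : ∀ i, w i ≠ 0) (hε : 0 < ε)
    (hx : x ∈ Set.Icc (0 : Fin d → ℝ) 1) (hz : ∀ i, 0 < boxSlack w x i) :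
    hammingNorm (steepestDescentStep w ε π x) =
      ∑ m ∈ Finset.range d, if slackSum w x π m < ε then 1 else 0 := by
  have hne : ∀ i, steepestDescentStep w ε π x (π i) ≠ 0 ↔ slackSum w x π i < ε := fun i => by
    rw [← lt_criticalIndex_iff hw hε hx i.isLt, steepestDescentStep_eq,
      mul_ne_zero_iff_right (by simpa [Real.sign_eq_zero_iff] using hw _), stepMagnitude,
      Equiv.symm_apply_apply]
    have := slackSum_criticalIndex_pred_lt (w := w) (x := x) (π := π) i.pos hε
    split_ifs with h1 h2
    · exact iff_of_true (hz _).ne' (by omega)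
    · exact iff_of_true (lt_min (hz _) (by linarith)).ne' (by omega)
    · exact iff_of_false (by simp) (by omega)
  rw [← Fin.sum_univ_eq_sum_range (fun m => if slackSum w x π m < ε then 1 else 0),
    hammingNorm, Finset.card_filter, ← Equiv.sum_comp π]
  exact Finset.sum_congr rfl fun i _ => if_congr (hne i) rfl rfl

end Step

/-! ### Uniform `x`: law of the slacks and the expectation. -/

section Uniform

open MeasureTheory ProbabilityTheory

variable {d : ℕ} {w : Fin d → ℝ} {ε : ℝ} {π : Equiv.Perm (Fin d)}

lemma isProbabilityMeasure_restrict_unitInterval :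
    IsProbabilityMeasure ((volume : Measure ℝ).restrict (Set.Icc 0 1)) :=
  ⟨by simp⟩

lemma volume_unitCube : volume (Set.Icc (0 : Fin d → ℝ) 1) = 1 := by
  simp [Real.volume_Icc_pi]

lemma cond_unitCube : cond volume (Set.Icc (0 : Fin d → ℝ) 1) =
    Measure.pi fun _ : Fin d => (volume : Measure ℝ).restrict (Set.Icc 0 1) := by
  rw [ProbabilityTheory.cond, volume_unitCube, inv_one, one_smul, ← Set.pi_univ_Icc, volume_pi,
    Measure.restrict_pi_pi]
  rfl

/-- `z_i` as a function of the single coordinate `x_i`. -/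
noncomputable def coordSlack (a u : ℝ) : ℝ := max ((1 - u) * Real.sign a) (-u * Real.sign a)

lemma measurable_coordSlack (a : ℝ) : Measurable (coordSlack a) := by
  unfold coordSlack
  fun_prop

lemma coordSlack_of_pos {a : ℝ} (h : 0 < a) : coordSlack a = fun u => 1 - u := by
  ext u
  rw [coordSlack, Real.sign_of_pos h, max_eq_left] <;> linarith

lemma coordSlack_of_neg {a : ℝ} (h : a < 0) : coordSlack a = fun u => u := by
  ext u
  rw [coordSlack, Real.sign_of_neg h, max_eq_right] <;> linarith

lemma map_coordSlack {a : ℝ} (ha : a ≠ 0) :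
    ((volume : Measure ℝ).restrict (Set.Icc 0 1)).map (coordSlack a) =
      volume.restrict (Set.Icc 0 1) := by
  rcases lt_or_gt_of_ne ha with h | h
  · rw [coordSlack_of_neg h]
    exact Measure.map_id
  · rw [coordSlack_of_pos h]
    have := ((Measure.measurePreserving_sub_left (volume : Measure ℝ) 1).restrict_preimage
      (measurableSet_Icc (a := (0 : ℝ)) (b := 1))).map_eq
    simpa using this

lemma measurable_boxSlack (i : Fin d) : Measurable fun x => boxSlack w x i :=
  (measurable_coordSlack (w i)).comp (measurable_pi_apply i)

lemma measurable_slackSum (m : ℕ) : Measurable fun x => slackSum w x π m :=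
  Finset.measurable_fun_sum _ fun i _ => measurable_boxSlack (π i)

lemma ae_boxSlack_pos (hw : ∀ i, w i ≠ 0) :
    ∀ᵐ x ∂cond volume (Set.Icc (0 : Fin d → ℝ) 1),
      x ∈ Set.Icc (0 : Fin d → ℝ) 1 ∧ ∀ i, 0 < boxSlack w x i := by
  refine (ae_cond_mem measurableSet_Icc).and ?_
  rw [cond_unitCube]
  have := isProbabilityMeasure_restrict_unitInterval
  refine ae_all_iff.2 fun i => ?_
  have h : ∀ᵐ u ∂(volume : Measure ℝ).restrict (Set.Icc 0 1), 0 < coordSlack (w i) u := by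
    have h0 : ∀ᵐ u ∂(volume : Measure ℝ).restrict (Set.Icc 0 1), 0 < u := by
      filter_upwards [ae_restrict_mem measurableSet_Icc,
        ae_restrict_of_ae (Measure.ae_ne volume (0 : ℝ))] with u hu hu'
      exact lt_of_le_of_ne hu.1 (Ne.symm hu')
    rw [← map_coordSlack (hw i)] at h0
    exact ae_of_ae_map (measurable_coordSlack _).aemeasurable h0
  exact (Measure.quasiMeasurePreserving_eval
    (fun _ : Fin d => (volume : Measure ℝ).restrict (Set.Icc 0 1)) i).ae h

/-- Each slack depends on its own coordinate only, so the product structure of the cube gives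
independence. -/
lemma cond_unitCube_slackSum_lt (hw : ∀ i, w i ≠ 0) {m : ℕ} (hm : m ≤ d) :
    (cond volume (Set.Icc (0 : Fin d → ℝ) 1)).real {x | slackSum w x π m < ε} =
      irwinHallCDF m ε := by
  have := isProbabilityMeasure_restrict_unitInterval
  have hind : iIndepFun (fun i (x : Fin d → ℝ) => coordSlack (w i) (x i))
      (Measure.pi fun _ : Fin d => (volume : Measure ℝ).restrict (Set.Icc 0 1)) :=
    iIndepFun_pi fun i => (measurable_coordSlack (w i)).aemeasurable
  have hcard : (Finset.univ.filter fun i : Fin d => i.val < m).card = m := by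
    rw [Fin.card_filter_val_lt, min_eq_right hm]
  have := measure_sum_uniform_lt (fun i => measurable_boxSlack (w := w) (π i))
    (hind.precomp π.injective) (fun i => ?_) (Finset.univ.filter fun i : Fin d => i.val < m) ε
  · rw [hcard] at this
    rw [cond_unitCube]
    exact this
  · change Measure.map (coordSlack (w (π i)) ∘ fun x : Fin d → ℝ => x (π i)) _ = _
    rw [← Measure.map_map (measurable_coordSlack _) (measurable_pi_apply _),
      show Measure.map (fun x : Fin d → ℝ => x (π i)) (Measure.pi fun _ : Fin d =>
        (volume : Measure ℝ).restrict (Set.Icc 0 1)) = _ from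
        (measurePreserving_eval _ (π i)).map_eq, map_coordSlack (hw _)]

variable {Ω : Type*} [MeasurableSpace Ω] {μ : Measure Ω} [IsProbabilityMeasure μ]
  {X : Ω → Fin d → ℝ}

theorem integral_hammingNorm_steepestDescentStep (hw : ∀ i, w i ≠ 0) (hε : 0 < ε)
    (hX : pdf.IsUniform X (Set.Icc (0 : Fin d → ℝ) 1) μ volume) :
    Integrable (fun ω => (hammingNorm (steepestDescentStep w ε π (X ω)) : ℝ)) μ ∧
      ∫ ω, (hammingNorm (steepestDescentStep w ε π (X ω)) : ℝ) ∂μ =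
        ∑ m ∈ Finset.range d, irwinHallCDF m ε := by
  -- Almost everywhere measurability comes from the law itself, as the cube has volume neither 0 nor
  -- infinite.
  have hXm : AEMeasurable X μ :=
    hX.aemeasurable (by simp [volume_unitCube]) (by simp [volume_unitCube])
  have hXlaw : μ.map X = cond volume (Set.Icc (0 : Fin d → ℝ) 1) := hX
  have hset : ∀ m, MeasurableSet {x : Fin d → ℝ | slackSum w x π m < ε} := fun m =>
    measurableSet_lt (measurable_slackSum m) measurable_const
  have hnull : ∀ m, NullMeasurableSet (X ⁻¹' {x | slackSum w x π m < ε}) μ := fun m =>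
    hXm.nullMeasurableSet_preimage (hset m)
  have hae : (fun ω => (hammingNorm (steepestDescentStep w ε π (X ω)) : ℝ)) =ᵐ[μ]
      fun ω => ∑ m ∈ Finset.range d,
        (X ⁻¹' {x | slackSum w x π m < ε}).indicator (fun _ => (1 : ℝ)) ω := by
    have h := ae_boxSlack_pos hw
    rw [← hXlaw] at h
    filter_upwards [ae_of_ae_map hXm h] with ω hω
    rw [hammingNorm_steepestDescentStep hw hε hω.1 hω.2]
    push_cast
    refine Finset.sum_congr rfl fun m _ => ?_
    simp [Set.indicator_apply]
  have hint : ∀ m ∈ Finset.range d, Integrable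
      ((X ⁻¹' {x | slackSum w x π m < ε}).indicator fun _ => (1 : ℝ)) μ := fun m _ =>
    (integrable_const 1).indicator₀ (hnull m)
  refine ⟨(integrable_finsetSum _ hint).congr hae.symm, ?_⟩
  rw [integral_congr_ae hae, integral_finsetSum _ hint]
  refine Finset.sum_congr rfl fun m hm => ?_
  rw [integral_indicator₀ (hnull m), setIntegral_const, smul_eq_mul, mul_one,
    ← cond_unitCube_slackSum_lt hw (Finset.mem_range.1 hm).le (π := π), ← hXlaw,
    map_measureReal_apply_of_aemeasurable hXm (hset m)]

end Uniform

/-! ### Closed form and lower bound for the expectation. -/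

lemma irwinHallCDF_nonneg_and_monotone (n : ℕ) :
    (∀ t, 0 ≤ irwinHallCDF n t) ∧ Monotone (irwinHallCDF n) := by
  induction n with
  | zero =>
    have h : irwinHallCDF 0 = truncatedPow 0 := by ext t; simp [irwinHallCDF]
    rw [h]
    refine ⟨fun t => ?_, truncatedPow_monotone 0⟩
    rw [truncatedPow]
    split_ifs <;> simp
  | succ n ih =>
    refine ⟨fun t => ?_, fun s t hst => ?_⟩
    · rw [← integral_irwinHallCDF_sub]
      exact intervalIntegral.integral_nonneg zero_le_one fun u _ => ih.1 _
    · rw [← integral_irwinHallCDF_sub, ← integral_irwinHallCDF_sub]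
      exact intervalIntegral.integral_mono_on zero_le_one
        (intervalIntegrable_irwinHallCDF_sub _ _ _ _)
        (intervalIntegrable_irwinHallCDF_sub _ _ _ _) fun u _ => ih.2 (by linarith)

lemma half_le_irwinHallCDF {n : ℕ} {t : ℝ} (ht : 0 < t) (h : n ≤ 2 * t) :
    1 / 2 ≤ irwinHallCDF n t := by
  have h1 := irwinHallCDF_symm n t (Or.inr ht.ne')
  have h2 := (irwinHallCDF_nonneg_and_monotone n).2 (show n - t ≤ t by linarith)
  linarith

lemma sum_irwinHallCDF_eq {d : ℕ} {ε : ℝ} (hε : 0 < ε) (hd : ⌊ε⌋₊ + 1 ≤ d) :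
    ∑ m ∈ Finset.range d, irwinHallCDF m ε =
      (⌊ε + 1⌋₊ : ℝ) + ∑ m ∈ Finset.Icc (⌊ε⌋₊ + 2) d, ∑ k ∈ Finset.range (⌊ε⌋₊ + 1),
        (-1 : ℝ) ^ k * ((ε - (k : ℝ)) ^ (m - 1) / ((k ! : ℝ) * ((m - 1 - k)! : ℝ))) := by
  rw [← Finset.sum_range_add_sum_Ico _ hd]
  congr 1
  · rw [Nat.floor_add_one hε.le, Finset.sum_congr rfl (g := fun _ => (1 : ℝ))]
    · simp
    · intro m hm
      exact irwinHallCDF_of_le hε ((Nat.le_floor_iff hε.le).1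
        (Nat.lt_succ_iff.1 (Finset.mem_range.1 hm)))
  -- The stated sum runs over positions, one more than the number of preceding slacks.
  · have : Finset.Icc (⌊ε⌋₊ + 2) d = Finset.Ico (⌊ε⌋₊ + 1 + 1) (d + 1) := by
      ext; simp; omega
    rw [this, ← Finset.sum_Ico_add' _ (⌊ε⌋₊ + 1) d 1]
    refine Finset.sum_congr rfl fun m hm => ?_
    rw [irwinHallCDF_eq_sum_floor hε.le (Finset.mem_Ico.1 hm).1, Nat.add_sub_cancel]

lemma le_sum_irwinHallCDF {d : ℕ} {ε : ℝ} (hε : 0 < ε) (hd : ⌊2 * ε⌋₊ + 1 ≤ d) :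
    ((⌊3 * ε⌋₊ : ℝ) + 1) / 2 ≤ ∑ m ∈ Finset.range d, irwinHallCDF m ε := by
  have hε2 : 0 ≤ 2 * ε := by linarith
  have h12 : ⌊ε⌋₊ + 1 ≤ ⌊2 * ε⌋₊ + 1 := Nat.succ_le_succ (Nat.floor_mono (by linarith))
  -- `3ε = ε + 2ε` lies strictly below `⌊ε⌋ + ⌊2ε⌋ + 2`.
  have h3 : ⌊3 * ε⌋₊ ≤ ⌊2 * ε⌋₊ + ⌊ε⌋₊ + 1 := by
    refine Nat.lt_succ_iff.1 ((Nat.floor_lt (by linarith)).2 ?_)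
    have h1 := Nat.lt_floor_add_one ε
    have h2 := Nat.lt_floor_add_one (2 * ε)
    push_cast
    linarith
  have h3' : (⌊3 * ε⌋₊ : ℝ) ≤ ⌊2 * ε⌋₊ + ⌊ε⌋₊ + 1 := by exact_mod_cast h3
  have hA : ∑ m ∈ Finset.range (⌊ε⌋₊ + 1), irwinHallCDF m ε = ⌊ε⌋₊ + 1 := by
    rw [Finset.sum_congr rfl (g := fun _ => (1 : ℝ))]
    · simp
    · intro m hm
      exact irwinHallCDF_of_le hε ((Nat.le_floor_iff hε.le).1
        (Nat.lt_succ_iff.1 (Finset.mem_range.1 hm)))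
  have hB : ((⌊2 * ε⌋₊ : ℝ) - ⌊ε⌋₊) * (1 / 2) ≤
      ∑ m ∈ Finset.Ico (⌊ε⌋₊ + 1) (⌊2 * ε⌋₊ + 1), irwinHallCDF m ε := by
    have := Finset.card_nsmul_le_sum (Finset.Ico (⌊ε⌋₊ + 1) (⌊2 * ε⌋₊ + 1))
      (fun m => irwinHallCDF m ε) (1 / 2) fun m hm => half_le_irwinHallCDF hε
        ((Nat.le_floor_iff hε2).1 (Nat.lt_succ_iff.1 (Finset.mem_Ico.1 hm).2))
    rw [Nat.card_Ico, nsmul_eq_mul, Nat.cast_sub h12] at this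
    push_cast at this
    linarith
  have hC : ∑ m ∈ Finset.range (⌊2 * ε⌋₊ + 1), irwinHallCDF m ε ≤
      ∑ m ∈ Finset.range d, irwinHallCDF m ε :=
    Finset.sum_le_sum_of_subset_of_nonneg (Finset.range_mono hd) fun m _ _ =>
      (irwinHallCDF_nonneg_and_monotone m).1 ε
  rw [← Finset.sum_range_add_sum_Ico _ h12] at hC
  linarith

theorem mainTheorem4 {d : ℕ} (w : Fin d → ℝ) (hw : ∀ i, w i ≠ 0)
    (π : Equiv.Perm (Fin d)) (hπ : Antitone fun i => |w (π i)|)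
    (ε : ℝ) (hε : 0 < ε) (hεd : ε ≤ ((d : ℝ) - 1) / 2)
    {Ω : Type*} [MeasurableSpace Ω] (μ : MeasureTheory.Measure Ω)
    [MeasureTheory.IsProbabilityMeasure μ] (X : Ω → Fin d → ℝ)
    (hX : MeasureTheory.pdf.IsUniform X (Set.Icc (0 : Fin d → ℝ) 1) μ MeasureTheory.volume) :
    (∀ x ∈ Set.Icc (0 : Fin d → ℝ) 1,
      IsSteepestDescentSolution w x ε (steepestDescentStep w ε π x)) ∧
    ((Function.Injective fun i => |w i|) →
      ∀ x ∈ Set.Icc (0 : Fin d → ℝ) 1, ∀ δ : Fin d → ℝ,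
        IsSteepestDescentSolution w x ε δ → δ = steepestDescentStep w ε π x) ∧
    MeasureTheory.Integrable
      (fun ω => (hammingNorm (steepestDescentStep w ε π (X ω)) : ℝ)) μ ∧
    ∫ ω, (hammingNorm (steepestDescentStep w ε π (X ω)) : ℝ) ∂μ =
      (⌊ε + 1⌋₊ : ℝ) + ∑ m ∈ Finset.Icc (⌊ε⌋₊ + 2) d, ∑ k ∈ Finset.range (⌊ε⌋₊ + 1),
        (-1 : ℝ) ^ k * ((ε - (k : ℝ)) ^ (m - 1) / ((k ! : ℝ) * ((m - 1 - k)! : ℝ))) ∧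
    ((⌊3 * ε⌋₊ : ℝ) + 1) / 2 ≤
      ∫ ω, (hammingNorm (steepestDescentStep w ε π (X ω)) : ℝ) ∂μ := by

  -- The upper bound on `ε` enters here: all indices `m ≤ 2ε` occur in the sum over `m < d`.
  have h2 : ⌊2 * ε⌋₊ + 1 ≤ d := by
    have h : (⌊2 * ε⌋₊ : ℝ) + 1 ≤ d := by
      have := Nat.floor_le (show 0 ≤ 2 * ε by linarith)
      linarith
    exact_mod_cast h
  have hd : 1 ≤ d := by omega
  have h1 : ⌊ε⌋₊ + 1 ≤ d :=
    (Nat.succ_le_succ (Nat.floor_mono (by linarith))).trans h2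
  obtain ⟨hint, hE⟩ := integral_hammingNorm_steepestDescentStep (π := π) hw hε hX
  refine ⟨fun x hx => isSteepestDescentSolution_step hw hπ hd hε hx,
    fun hinj x hx δ hδ => hδ.eq_step hw hπ hinj hd hε hx, hint, ?_, ?_⟩
  · rw [hE, sum_irwinHallCDF_eq hε h1]
  · rw [hE]
    exact le_sum_irwinHallCDF hε h2
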